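/- Let $n\ge 2$ and let $\mathcal O_n$ be the Cuntz algebra, i.e. the universal unital $C^*$-algebra generated by elements $S_1,\dots,S_n$ subject to $S_i^*S_i=1$ for all $i$ and $\sum_{i=1}^n S_iS_i^*=1$. Let $\alpha$ be the gauge action of the circle group $\mathbb S^1$ on $\mathcal O_n$, determined by $\alpha_z(S_i)=zS_i$ for $z\in\mathbb S^1$, $1\le i\le n$. For an action $\beta$ of a compact group $G$ on a unital $C^*$-algebra $A$, the weak local-triviality dimension of $\beta$ is the smallest $d\in\mathbb N=\{0,1,2,\dots\}$ for which there exist $G$-equivariant (not necessarily unital) $*$-homomorphisms $\rho_0,\dots,\rho_d: C_0((0,1])\otimes C(G)\to A$ such that $\sum_{i=0}^d\rho_i(t\otimes 1)$ is invertible in $A$, and it is $\infty$ if there is no such $d$. Here $t$ is the identity function on $(0,1]$, and $G$ acts trivially on $C_0((0,1])$ and by translation, $(g\cdot f)(h)=f(hg)$, on $C(G)$. Then: 1. If $x\in\mathcal O_n$ is normal ($x^*x=xx^*$) and of degree one ($\alpha_z(x)=zx$ for all $z\in\mathbb S^1$), then $x=0$. 2. Consequently, the gauge action of $\mathbb S^1$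 on $\mathcal O_n$ has infinite weak local-triviality dimension. -/

import Mathlib

open scoped ENNReal ZeroAtInfty CStarAlgebra

universe u v

noncomputable section

/-! ### Local triviality: the weak local-triviality dimension of an action -/

namespace LocalTriviality

variable (G : Type u) [TopologicalSpace G]

/-- The C⋆-algebra `C₀((0,1]) ⊗ C(G)` of a compact group `G`, in its standard form
`C₀((0,1] × G)`; the elementary tensor `h ⊗ f` is the function `(s, g) ↦ h s * f g`. -/
abbrev ConeAlgebra : Type u := C₀(Set.Ioc (0 : ℝ) 1 × G, ℂ)

/-- The element `t ⊗ 1` of `C₀((0,1]) ⊗ C(G)`, i.e. the function `(s, g) ↦ s`. -/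
def coneT [CompactSpace G] : ConeAlgebra G where
  toFun p := ((p.1 : ℝ) : ℂ)
  continuous_toFun := by fun_prop
  zero_at_infty' := by
    rw [Metric.tendsto_nhds]
    intro ε hε
    rw [Filter.Eventually, Filter.mem_cocompact]
    refine ⟨(Subtype.val ⁻¹' Set.Icc (min ε 1) 1) ×ˢ Set.univ, ?_, ?_⟩
    · refine IsCompact.prod ?_ isCompact_univ
      rw [Subtype.isCompact_iff, Subtype.image_preimage_coe]
      have h : Set.Ioc (0 : ℝ) 1 ∩ Set.Icc (min ε 1) 1 = Set.Icc (min ε 1) 1 := by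
        refine Set.inter_eq_right.mpr fun x hx => ⟨lt_of_lt_of_le ?_ hx.1, hx.2⟩
        exact lt_min hε one_pos
      rw [h]
      exact isCompact_Icc
    · rintro ⟨⟨s, hs0, hs1⟩, g⟩ hp
      simp only [Set.mem_compl_iff, Set.mem_prod, Set.mem_preimage, Set.mem_Icc, Set.mem_univ,
        and_true, not_and, not_le] at hp
      have hs : s < ε := by
        by_contra h
        exact absurd hs1 (not_le.mpr (hp ((min_le_left _ _).trans (not_lt.mp h))))
      simpa [abs_of_pos hs0] using hs

variable {G} [Group G] [ContinuousMul G]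

/-- The action of `G` on `C₀((0,1]) ⊗ C(G)` that is trivial on the first factor and translation
`(α_g f)(h) = f (h g)` on the second. -/
def coneTranslate (g : G) (f : ConeAlgebra G) : ConeAlgebra G :=
  f.comp
    { toFun := fun p => (p.1, p.2 * g)
      continuous_toFun := by fun_prop
      cocompact_tendsto' :=
        ((Homeomorph.refl _).prodCongr (Homeomorph.mulRight g)).isClosedEmbedding.tendsto_cocompact }

@[simp]
theorem coneTranslate_apply (g : G) (f : ConeAlgebra G) (s : Set.Ioc (0 : ℝ) 1) (h : G) :
    coneTranslate g f (s, h) = f (s, h * g) := rfl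

/-- The weak local-triviality dimension of an action `α` of a compact group `G` on a unital
C⋆-algebra `A`: the smallest `n` for which there are `G`-equivariant (not necessarily unital)
⋆-homomorphisms `ρ₀, …, ρₙ : C₀((0,1]) ⊗ C(G) → A` with `∑ ρᵢ (t ⊗ 1)` invertible, and `∞` if there
is no such `n`. -/
def weakDim [CompactSpace G] {A : Type v} [CStarAlgebra A] (α : G →* (A ≃⋆ₐ[ℂ] A)) : ℕ∞ :=
  sInf {d : ℕ∞ | ∃ n : ℕ, d = n ∧ ∃ ρ : Fin (n + 1) → (ConeAlgebra G →⋆ₙₐ[ℂ] A),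
    (∀ i g f, ρ i (coneTranslate g f) = α g (ρ i f)) ∧ IsUnit (∑ i, ρ i (coneT G))}

end LocalTriviality

/-! ### The Cuntz algebra and its gauge action -/

namespace Cuntz

/-- The defining relations of the Cuntz algebra: `Sᵢ⋆ Sᵢ = 1` for all `i`, and `∑ Sᵢ Sᵢ⋆ = 1`. -/
structure Relations {n : ℕ} {B : Type*} [CStarAlgebra B] (S : Fin n → B) : Prop where
  isometry : ∀ i, star (S i) * S i = 1
  sum_range : ∑ i, S i * star (S i) = 1

/-- A Cuntz family: elements of a nonzero unital C⋆-algebra that satisfy the Cuntz relations.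
(The zero algebra contributes nothing to the universal algebra.) -/
structure Family (n : ℕ) where
  /-- the ambient C⋆-algebra -/
  carrier : Type u
  [alg : CStarAlgebra carrier]
  [nontriv : Nontrivial carrier]
  /-- the elements `S₁, …, Sₙ` -/
  gen : Fin n → carrier
  rel : Relations gen

attribute [instance] Family.alg Family.nontriv

variable (n : ℕ)

/-- The product (bounded families, supremum norm) of the C⋆-algebras of all Cuntz families. -/
abbrev Ambient : Type (u + 1) := lp (fun F : Family.{u} n => F.carrier) ∞

instance : CStarAlgebra (Ambient.{u} n) where

variable {n}

theorem Relations.norm_le {B : Type*} [CStarAlgebra B] [Nontrivial B] {S : Fin n → B}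
    (h : Relations S) (i : Fin n) : ‖S i‖ ≤ 1 := by
  have h1 := CStarRing.norm_star_mul_self (x := S i)
  rw [h.isometry i, norm_one] at h1
  nlinarith [norm_nonneg (S i)]

/-- The tuple `(Sᵢ)` of the `i`-th elements of all Cuntz families. -/
def ambientGen (i : Fin n) : Ambient.{u} n :=
  ⟨fun F => F.gen i, memℓp_infty ⟨1, by rintro _ ⟨F, rfl⟩; exact F.rel.norm_le i⟩⟩

@[simp]
theorem ambientGen_apply (i : Fin n) (F : Family.{u} n) : ambientGen i F = F.gen i := rfl

variable (n)

/-- The universal algebra inside the product of all Cuntz families: the closed unital ⋆-subalgebra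
generated by the tuples `S₁, …, Sₙ`. -/
def subalgebra : StarSubalgebra ℂ (Ambient.{u} n) :=
  (StarAlgebra.adjoin ℂ (Set.range (ambientGen (n := n)))).topologicalClosure

instance : IsClosed (subalgebra.{u} n : Set (Ambient.{u} n)) :=
  StarSubalgebra.isClosed_topologicalClosure _

end Cuntz

/-- The Cuntz algebra `𝒪ₙ`: the universal unital C⋆-algebra generated by elements `S₁, …, Sₙ`
subject to `Sᵢ⋆ Sᵢ = 1` and `∑ Sᵢ Sᵢ⋆ = 1`. It is realised as the closed unital ⋆-subalgebra that
`S₁, …, Sₙ` generate in the product of all Cuntz families; `CuntzAlgebra.existsUnique_lift` is its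
universal property. -/
def CuntzAlgebra (n : ℕ) : Type (u + 1) := Cuntz.subalgebra.{u} n

namespace CuntzAlgebra

instance (n : ℕ) : CStarAlgebra (CuntzAlgebra.{u} n) :=
  inferInstanceAs (CStarAlgebra (Cuntz.subalgebra.{u} n))

variable {n : ℕ}

/-- The inclusion of `𝒪ₙ` into the product of all Cuntz families. -/
def incl (n : ℕ) : CuntzAlgebra.{u} n →⋆ₐ[ℂ] Cuntz.Ambient.{u} n := (Cuntz.subalgebra.{u} n).subtype

theorem incl_injective : Function.Injective (incl.{u} n) := Subtype.val_injective

/-- The generators `S₁, …, Sₙ` of `𝒪ₙ`. -/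
def S (i : Fin n) : CuntzAlgebra.{u} n :=
  ⟨Cuntz.ambientGen i, StarSubalgebra.le_topologicalClosure _
    (StarAlgebra.subset_adjoin ℂ _ ⟨i, rfl⟩)⟩

@[simp]
theorem incl_S (i : Fin n) : incl.{u} n (S i) = Cuntz.ambientGen i := rfl

theorem relations : Cuntz.Relations (S : Fin n → CuntzAlgebra.{u} n) where
  isometry i := by
    apply incl_injective
    exact lp.ext (funext fun F => F.rel.isometry i)
  sum_range := by
    apply incl_injective
    refine lp.ext (funext fun F => ?_)
    rw [map_sum, lp.coeFn_sum, Finset.sum_apply]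
    exact F.rel.sum_range

/-- `S₁, …, Sₙ` generate `𝒪ₙ` as a unital C⋆-algebra. -/
theorem closure_adjoin_S :
    (StarAlgebra.adjoin ℂ (Set.range (S : Fin n → CuntzAlgebra.{u} n))).topologicalClosure = ⊤ := by
  have hmap : (StarAlgebra.adjoin ℂ (Set.range (S : Fin n → CuntzAlgebra.{u} n))).map (incl n) =
      StarAlgebra.adjoin ℂ (Set.range Cuntz.ambientGen) := by
    rw [StarAlgHom.map_adjoin, ← Set.range_comp]
    rfl
  rw [eq_top_iff]
  intro x _
  change x ∈ closure (_ : Set (CuntzAlgebra.{u} n))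
  have hind : Topology.IsInducing (incl.{u} n) := Topology.IsInducing.subtypeVal
  rw [hind.closure_eq_preimage_closure_image, Set.mem_preimage, ← StarSubalgebra.coe_map, hmap]
  exact x.2

/-- A unital ⋆-homomorphism out of `𝒪ₙ` is determined by the images of the generators. -/
theorem hom_ext {B : Type v} [CStarAlgebra B] {φ ψ : CuntzAlgebra.{u} n →⋆ₐ[ℂ] B}
    (h : ∀ i, φ (S i) = ψ (S i)) : φ = ψ := by
  have hcl : IsClosed {x | φ x = ψ x} := isClosed_eq (map_continuous φ) (map_continuous ψ)
  have hle : StarAlgebra.adjoin ℂ (Set.range (S : Fin n → CuntzAlgebra.{u} n)) ≤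
      StarAlgHom.equalizer φ ψ := by
    apply StarAlgHom.adjoin_le_equalizer
    rintro _ ⟨i, rfl⟩
    exact h i
  ext x
  have hx := StarSubalgebra.topologicalClosure_minimal hle hcl
  rw [closure_adjoin_S] at hx
  exact hx (show x ∈ ⊤ from trivial)

/-- The universal property of `𝒪ₙ`. -/
theorem existsUnique_lift {B : Type u} [CStarAlgebra B] (T : Fin n → B) (hT : Cuntz.Relations T) :
    ∃! φ : CuntzAlgebra.{u} n →⋆ₐ[ℂ] B, ∀ i, φ (S i) = T i := by
  suffices h : ∃ φ : CuntzAlgebra.{u} n →⋆ₐ[ℂ] B, ∀ i, φ (S i) = T i by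
    obtain ⟨φ, hφ⟩ := h
    exact ⟨φ, hφ, fun ψ hψ => hom_ext fun i => (hψ i).trans (hφ i).symm⟩
  cases subsingleton_or_nontrivial B with
  | inl hB =>
    exact ⟨{ toFun := fun _ => 0
             map_one' := Subsingleton.elim _ _
             map_mul' := fun _ _ => Subsingleton.elim _ _
             map_zero' := rfl
             map_add' := fun _ _ => Subsingleton.elim _ _
             commutes' := fun _ => Subsingleton.elim _ _
             map_star' := fun _ => Subsingleton.elim _ _ }, fun _ => Subsingleton.elim _ _⟩
  | inr hB =>
    let F : Cuntz.Family.{u} n := { carrier := B, gen := T, rel := hT }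
    let ev : Cuntz.Ambient.{u} n →⋆ₐ[ℂ] B :=
      { toFun := fun f => f F
        map_one' := rfl
        map_mul' := fun _ _ => rfl
        map_zero' := rfl
        map_add' := fun _ _ => rfl
        commutes' := fun _ => rfl
        map_star' := fun _ => rfl }
    exact ⟨ev.comp (incl n), fun _ => rfl⟩

end CuntzAlgebra

namespace Cuntz

variable {n : ℕ}

theorem Relations.smul {B : Type*} [CStarAlgebra B] {T : Fin n → B} (h : Relations T)
    (z : Circle) : Relations fun i => (z : ℂ) • T i where
  isometry i := by
    rw [star_smul, smul_mul_smul_comm, h.isometry i]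
    simp [← Circle.coe_inv_eq_conj]
  sum_range := by
    rw [← h.sum_range]
    refine Finset.sum_congr rfl fun i _ => ?_
    rw [star_smul, smul_mul_smul_comm]
    simp [← Circle.coe_inv_eq_conj]

/-- The Cuntz family `(z S₁, …, z Sₙ)`, for `z` in the unit circle. -/
def Family.rotate (z : Circle) (F : Family.{u} n) : Family.{u} n where
  carrier := F.carrier
  gen i := (z : ℂ) • F.gen i
  rel := F.rel.smul z

/-- Rotation of the coordinates of the product of all Cuntz families; it maps `Sᵢ` to `z Sᵢ`. -/
def ambientGauge (z : Circle) : Ambient.{u} n →⋆ₐ[ℂ] Ambient.{u} n where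
  toFun f := ⟨fun F => f (F.rotate z), memℓp_infty ⟨‖f‖, by
    rintro _ ⟨F, rfl⟩; exact lp.norm_apply_le_norm ENNReal.top_ne_zero f (F.rotate z)⟩⟩
  map_one' := rfl
  map_mul' _ _ := rfl
  map_zero' := rfl
  map_add' _ _ := rfl
  commutes' _ := rfl
  map_star' _ := rfl

theorem ambientGauge_gen (z : Circle) (i : Fin n) :
    ambientGauge z (ambientGen.{u} i) = (z : ℂ) • ambientGen i := rfl

theorem ambientGauge_mem (z : Circle) (x : subalgebra.{u} n) :
    ambientGauge z (x : Ambient.{u} n) ∈ subalgebra.{u} n := by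
  have hle : subalgebra.{u} n ≤ (subalgebra.{u} n).comap (ambientGauge z) := by
    refine StarSubalgebra.topologicalClosure_minimal ?_ ?_
    · refine StarAlgebra.adjoin_le ?_
      rintro _ ⟨i, rfl⟩
      exact (subalgebra.{u} n).smul_mem (CuntzAlgebra.S i).2 (z : ℂ)
    · exact (StarSubalgebra.isClosed_topologicalClosure _).preimage
        (map_continuous (ambientGauge.{u} (n := n) z))
  exact hle x.2

end Cuntz

namespace CuntzAlgebra

variable {n : ℕ}

/-- The ⋆-endomorphism of `𝒪ₙ` with `Sᵢ ↦ z Sᵢ`. -/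
def gaugeHom (z : Circle) : CuntzAlgebra.{u} n →⋆ₐ[ℂ] CuntzAlgebra.{u} n :=
  ((Cuntz.ambientGauge z).comp (incl n)).codRestrict (Cuntz.subalgebra.{u} n)
    (Cuntz.ambientGauge_mem z)

theorem gaugeHom_S (z : Circle) (i : Fin n) :
    gaugeHom.{u} z (S i) = (z : ℂ) • S i := rfl

theorem gaugeHom_one : gaugeHom.{u} (n := n) 1 = StarAlgHom.id ℂ _ :=
  hom_ext fun i => by simp [gaugeHom_S]

theorem gaugeHom_mul (z w : Circle) :
    gaugeHom.{u} (n := n) (z * w) = (gaugeHom z).comp (gaugeHom w) :=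
  hom_ext fun i => by simp [gaugeHom_S, map_smul, smul_smul, mul_comm]

variable (n)

/-- The gauge action of the circle on `𝒪ₙ`, given by `Sᵢ ↦ z Sᵢ`. -/
def gauge : Circle →* (CuntzAlgebra.{u} n ≃⋆ₐ[ℂ] CuntzAlgebra.{u} n) where
  toFun z := StarAlgEquiv.ofStarAlgHom (gaugeHom z) (gaugeHom z⁻¹)
    (by rw [← gaugeHom_mul, inv_mul_cancel, gaugeHom_one])
    (by rw [← gaugeHom_mul, mul_inv_cancel, gaugeHom_one])
  map_one' := StarAlgEquiv.ext fun x => DFunLike.congr_fun gaugeHom_one x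
  map_mul' z w := StarAlgEquiv.ext fun x => DFunLike.congr_fun (gaugeHom_mul z w) x

@[simp]
theorem gauge_S (z : Circle) (i : Fin n) : gauge.{u} n z (S i) = (z : ℂ) • S i := rfl

/-- The degree `d` component `{x | α_z(x) = z ^ d x for all z}` of `𝒪ₙ` for the gauge action. -/
def degree (d : ℤ) : Submodule ℂ (CuntzAlgebra.{u} n) where
  carrier := {x | ∀ z : Circle, gauge n z x = (z : ℂ) ^ d • x}
  add_mem' hx hy z := by rw [map_add, hx z, hy z, smul_add]
  zero_mem' z := by rw [map_zero, smul_zero]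
  smul_mem' c x hx z := by rw [map_smul, hx z, smul_comm]

end CuntzAlgebra

end

/-! The proof rests on a state `φ` (`kmsState`) that scales commutators by degree: `φ(b a) = n^(-d)
φ(a b)` for `b` of degree `d` (`degree_le_kmsSubmodule`). If `x` is normal of degree one, then
`φ(x⋆x) = φ(xx⋆) = n⁻¹ φ(x⋆x)`, so `φ(x⋆x) = 0` because `n ≠ 1`. It remains to see that `φ` is
faithful enough to give `x⋆x = 0`.

The state is the limit of the iterates of `Φ(a) = n⁻¹ ∑ Sᵢ⋆ a Sᵢ`: on every product `S_μ S_ν⋆` these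
converge to a scalar, and contractivity carries this to the closed span, which is all of `𝒪ₙ`
(`mem_scalarLimit`). The scaling rule holds for the generators since `φ ∘ Φ = φ`; it extends to
degree `d` because words of degree `d` span a dense subspace there
(`degree_subset_closure_wordSpan`).

Faithfulness is needed only in degree zero, where elements are limits of images of the matrix
algebras `M_{nᵏ}(ℂ)`. Cauchy–Schwarz gives `φ(x⋆x c) = 0` for all `c`; the scaling rule then makes
all matrix coefficients of an approximant of `x⋆x` small, hence its norm small
(`eq_zero_of_kmsState_mul_eq_zero`).

For the dimension, `t ⊗ u` with `u` the inclusion of the circle is normal of degree one. Each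
equivariant `ρᵢ` therefore kills it, and with it `t ⊗ 1`, so the sum is zero and not invertible. -/

open Filter Topology

/-! ### Words in the generators and the averaged compression -/

namespace Cuntz

variable {n : ℕ} {A : Type*} [CStarAlgebra A] {S : Fin n → A}

/-- Conjugating `∑ Sₖ Sₖ⋆ = 1` by `Sⱼ` writes `1` as a sum of positive elements whose `j`-th term is
already `1`; the other terms must vanish. -/
theorem Relations.star_gen_mul_gen (h : Relations S) (i j : Fin n) :
    star (S i) * S j = if i = j then 1 else 0 := by
  let := CStarAlgebra.spectralOrder A
  have := CStarAlgebra.spectralOrderedRing A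
  split_ifs with hij
  · rw [hij, h.isometry]
  have h1 : ∑ k, star (star (S k) * S j) * (star (S k) * S j) = 1 := by
    calc _ = star (S j) * (∑ k, S k * star (S k)) * S j := by
          simp [Finset.mul_sum, Finset.sum_mul, mul_assoc]
      _ = 1 := by rw [h.sum_range, mul_one, h.isometry]
  rw [← Finset.add_sum_erase _ _ (Finset.mem_univ j), h.isometry j, star_one, one_mul,
    add_eq_left, Finset.sum_eq_zero_iff_of_nonneg fun _ _ => star_mul_self_nonneg _] at h1
  exact (CStarRing.star_mul_self_eq_zero_iff _).mp (h1 i (by simp [hij]))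

/-- The product `S_{i₁} ⋯ S_{iₖ}` along the word `[i₁, …, iₖ]`. -/
def word (S : Fin n → A) (l : List (Fin n)) : A := (l.map S).prod

@[simp] theorem word_nil : word S [] = 1 := rfl

@[simp] theorem word_cons (i : Fin n) (l : List (Fin n)) : word S (i :: l) = S i * word S l := by
  simp [word]

theorem word_append (l l' : List (Fin n)) : word S (l ++ l') = word S l * word S l' := by
  simp [word]

theorem Relations.star_word_mul_word (h : Relations S) :
    ∀ l l' : List (Fin n), l.length = l'.length →
      star (word S l) * word S l' = if l = l' then 1 else 0
  | [], [], _ => by simp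
  | i :: l, j :: l', hl => by
    have ih := h.star_word_mul_word l l' (by simpa using hl)
    calc star (word S (i :: l)) * word S (j :: l')
        = star (word S l) * (star (S i) * S j) * word S l' := by simp [mul_assoc]
      _ = _ := by
        rw [h.star_gen_mul_gen]
        by_cases hij : i = j <;> simp [hij, ih]

theorem Relations.norm_word_le [Nontrivial A] (h : Relations S) (l : List (Fin n)) :
    ‖word S l‖ ≤ 1 := by
  induction l with
  | nil => simp
  | cons i l ih =>
    rw [word_cons]
    exact (norm_mul_le _ _).trans (mul_le_one₀ (h.norm_le i) (norm_nonneg _) ih)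

/-- The averaged compression `a ↦ n⁻¹ ∑ Sᵢ⋆ a Sᵢ`. -/
noncomputable def compress (S : Fin n → A) : A →ₗ[ℂ] A where
  toFun a := (n : ℂ)⁻¹ • ∑ i, star (S i) * a * S i
  map_add' a b := by simp [mul_add, add_mul, Finset.sum_add_distrib]
  map_smul' c a := by simp [← Finset.smul_sum, smul_comm c]

theorem compress_apply (a : A) : compress S a = (n : ℂ)⁻¹ • ∑ i, star (S i) * a * S i := rfl

theorem compress_star (a : A) : compress S (star a) = star (compress S a) := by
  simp [compress_apply, star_sum, mul_assoc]

theorem Relations.compress_mul_left (h : Relations S) (i : Fin n) (a : A) :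
    compress S (S i * a) = (n : ℂ)⁻¹ • (a * S i) := by
  simp [compress_apply, ← mul_assoc, h.star_gen_mul_gen]

theorem Relations.compress_mul_star (h : Relations S) (i : Fin n) (a : A) :
    compress S (a * star (S i)) = (n : ℂ)⁻¹ • (star (S i) * a) := by
  simp [compress_apply, mul_assoc, h.star_gen_mul_gen]

theorem Relations.compress_one (h : Relations S) (hn : n ≠ 0) : compress S 1 = 1 := by
  simp [compress_apply, h.isometry, ← Nat.cast_smul_eq_nsmul ℂ, smul_smul, hn]

theorem Relations.norm_compress_le [Nontrivial A] (h : Relations S) (a : A) :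
    ‖compress S a‖ ≤ ‖a‖ := by
  rcases eq_or_ne n 0 with rfl | hn
  · simp [compress_apply]
  have hb : ‖∑ i, star (S i) * a * S i‖ ≤ n * ‖a‖ := by
    refine (norm_sum_le_of_le (f := fun i => star (S i) * a * S i) (n := fun _ => ‖a‖) _
      fun i _ => ?_).trans_eq (by simp)
    calc ‖star (S i) * a * S i‖ ≤ ‖star (S i)‖ * ‖a‖ * ‖S i‖ := norm_mul₃_le
      _ ≤ 1 * ‖a‖ * 1 := by
        have := h.norm_le i
        rw [norm_star]
        gcongr
      _ = ‖a‖ := by ring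
  have hn' : (0 : ℝ) < n := by positivity
  rw [compress_apply, norm_smul, norm_inv, Complex.norm_natCast, inv_mul_le_iff₀ hn']
  exact hb

theorem Relations.norm_compress_pow_le [Nontrivial A] (h : Relations S) (m : ℕ) (a : A) :
    ‖(compress S ^ m) a‖ ≤ ‖a‖ := by
  induction m with
  | zero => simp
  | succ m ih =>
    rw [pow_succ', Module.End.mul_apply]
    exact (h.norm_compress_le _).trans ih

theorem Relations.compress_pow_one (h : Relations S) (hn : n ≠ 0) (m : ℕ) :
    (compress S ^ m) 1 = 1 := by
  induction m with
  | zero => simp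
  | succ m ih => rw [pow_succ, Module.End.mul_apply, h.compress_one hn, ih]

theorem compress_pow_star (m : ℕ) (a : A) :
    (compress S ^ m) (star a) = star ((compress S ^ m) a) := by
  induction m generalizing a with
  | zero => simp
  | succ m ih => rw [pow_succ, Module.End.mul_apply, Module.End.mul_apply, compress_star, ih]

/-- Compression moves the first letter of a word to its end and contributes a factor `n⁻¹`, so the
word stays nonempty and the step repeats. -/
theorem Relations.norm_compress_pow_word_le [Nontrivial A] (h : Relations S) (m : ℕ)
    (l : List (Fin n)) (hl : l ≠ []) : ‖(compress S ^ m) (word S l)‖ ≤ ((n : ℝ)⁻¹) ^ m := by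
  induction m generalizing l with
  | zero => simpa using h.norm_word_le l
  | succ m ih =>
    obtain ⟨i, l, rfl⟩ := List.exists_cons_of_ne_nil hl
    have hw : word S l * S i = word S (l ++ [i]) := by simp [word_append]
    rw [pow_succ, Module.End.mul_apply, word_cons, h.compress_mul_left, hw, map_smul, norm_smul,
      norm_inv, Complex.norm_natCast, pow_succ']
    gcongr
    exact ih _ (by simp)

/-! ### Convergence of iterated compressions to scalars -/

variable (S) in
/-- The elements whose iterated averaged compressions converge to a scalar. -/
def scalarLimit : Submodule ℂ A where
  carrier := {a | ∃ c : ℂ, Tendsto (fun m => (compress S ^ m) a) atTop (𝓝 (c • 1))}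
  add_mem' := by
    rintro a b ⟨c, hc⟩ ⟨d, hd⟩
    exact ⟨c + d, by simpa [add_smul] using hc.add hd⟩
  zero_mem' := ⟨0, by simp⟩
  smul_mem' := by
    rintro r a ⟨c, hc⟩
    exact ⟨r * c, by simpa [mul_smul] using hc.const_smul r⟩

theorem mem_scalarLimit {a : A} : a ∈ scalarLimit S ↔
    ∃ c : ℂ, Tendsto (fun m => (compress S ^ m) a) atTop (𝓝 (c • 1)) := Iff.rfl

theorem star_mem_scalarLimit {a : A} (ha : a ∈ scalarLimit S) : star a ∈ scalarLimit S := by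
  obtain ⟨c, hc⟩ := ha
  refine ⟨star c, ?_⟩
  simp only [compress_pow_star]
  simpa using hc.star

theorem mem_scalarLimit_of_compress {a : A} (ha : compress S a ∈ scalarLimit S) :
    a ∈ scalarLimit S := by
  obtain ⟨c, hc⟩ := ha
  exact ⟨c, (tendsto_add_atTop_iff_nat 1).mp hc⟩

/-- The iterates are contractions, so approximation within `ε` by an element of the subspace
controls all of them at once. The orbit is then Cauchy, and its limit lies in the closed line `ℂ 1`.
-/
theorem Relations.isClosed_scalarLimit [Nontrivial A] (h : Relations S) :
    IsClosed (scalarLimit S : Set A) := by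
  refine isClosed_of_closure_subset fun a ha => ?_
  have hcl : IsClosed ((ℂ ∙ (1 : A) : Submodule ℂ A) : Set A) :=
    Submodule.closed_of_finiteDimensional _
  have key : ∀ ε > 0, ∃ c : ℂ, ∀ᶠ m in atTop, ‖(compress S ^ m) a - c • 1‖ < ε := by
    intro ε hε
    obtain ⟨b, ⟨c, hc⟩, hb⟩ := Metric.mem_closure_iff.mp ha (ε / 2) (half_pos hε)
    refine ⟨c, ?_⟩
    filter_upwards [Metric.tendsto_nhds.mp hc (ε / 2) (half_pos hε)] with m hm
    rw [dist_eq_norm] at hm hb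
    calc ‖(compress S ^ m) a - c • 1‖
        = ‖(compress S ^ m) (a - b) + ((compress S ^ m) b - c • 1)‖ := by rw [map_sub]; congr 1; abel
      _ ≤ ‖(compress S ^ m) (a - b)‖ + ‖(compress S ^ m) b - c • 1‖ := norm_add_le _ _
      _ < ε := by linarith [h.norm_compress_pow_le m (a - b)]
  have hcau : CauchySeq fun m => (compress S ^ m) a := by
    rw [Metric.cauchySeq_iff]
    intro ε hε
    obtain ⟨c, hc⟩ := key (ε / 2) (half_pos hε)
    obtain ⟨N, hN⟩ := eventually_atTop.mp hc
    refine ⟨N, fun m hm k hk => ?_⟩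
    have := dist_triangle_right ((compress S ^ m) a) ((compress S ^ k) a) (c • 1)
    simp only [dist_eq_norm] at this ⊢
    linarith [hN m hm, hN k hk]
  obtain ⟨y, hy⟩ := cauchySeq_tendsto_of_complete hcau
  have hmem : y ∈ (ℂ ∙ (1 : A) : Submodule ℂ A) := by
    rw [← SetLike.mem_coe, ← hcl.closure_eq, Metric.mem_closure_iff]
    intro ε hε
    obtain ⟨c, hc⟩ := key (ε / 2) (half_pos hε)
    refine ⟨c • 1, Submodule.smul_mem _ _ (Submodule.mem_span_singleton_self _), ?_⟩
    rw [dist_eq_norm]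
    have := le_of_tendsto (hy.sub_const (c • 1)).norm (hc.mono fun _ h => h.le)
    linarith
  obtain ⟨c, rfl⟩ := Submodule.mem_span_singleton.mp hmem
  exact ⟨c, hy⟩

theorem Relations.word_mem_scalarLimit [Nontrivial A] (h : Relations S) (hn : 2 ≤ n)
    (l : List (Fin n)) : word S l ∈ scalarLimit S := by
  rcases eq_or_ne l [] with rfl | hl
  · exact ⟨1, by simp [h.compress_pow_one (by omega : n ≠ 0)]⟩
  · refine ⟨0, ?_⟩
    rw [zero_smul]
    refine squeeze_zero_norm (fun m => h.norm_compress_pow_word_le m l hl) ?_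
    refine tendsto_pow_atTop_nhds_zero_of_lt_one (by positivity) (inv_lt_one_of_one_lt₀ ?_)
    exact_mod_cast hn

/-- One compression strips the first letter of both words, with result zero if these differ. The
induction ends when one word is empty, leaving a pure word or its adjoint. -/
theorem Relations.word_mul_star_word_mem_scalarLimit [Nontrivial A] (h : Relations S)
    (hn : 2 ≤ n) : ∀ l l' : List (Fin n), word S l * star (word S l') ∈ scalarLimit S
  | [], l' => by
    rw [word_nil, one_mul]
    exact star_mem_scalarLimit (h.word_mem_scalarLimit hn l')
  | i :: l, [] => by
    simpa using h.word_mem_scalarLimit hn (i :: l)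
  | i :: l, j :: l' => by
    apply mem_scalarLimit_of_compress
    have ih := h.word_mul_star_word_mem_scalarLimit hn l l'
    have : compress S (word S (i :: l) * star (word S (j :: l'))) =
        (n : ℂ)⁻¹ • (if j = i then word S l * star (word S l') else 0) := by
      rw [word_cons, mul_assoc, h.compress_mul_left, word_cons]
      simp only [star_mul, mul_assoc, h.star_gen_mul_gen, mul_ite, mul_one, mul_zero]
    rw [this]
    refine Submodule.smul_mem _ _ ?_
    split_ifs
    exacts [ih, Submodule.zero_mem _]

/-- A system of isometries with orthogonal ranges induces a ⋆-homomorphism from a matrix algebra. -/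
noncomputable def matrixHom {ι : Type*} [Fintype ι] [DecidableEq ι] (s : ι → A)
    (hs : ∀ i j, star (s i) * s j = if i = j then 1 else 0) : Matrix ι ι ℂ →⋆ₙₐ[ℂ] A where
  toFun B := ∑ i, ∑ j, B i j • (s i * star (s j))
  map_smul' c B := by simp [Finset.smul_sum, smul_smul]
  map_zero' := by simp
  map_add' B C := by simp [add_smul, Finset.sum_add_distrib]
  map_mul' B C := by
    have key : ∀ i j k l, s i * star (s j) * (s k * star (s l)) =
        if j = k then s i * star (s l) else 0 := by
      intro i j k l
      rw [mul_assoc, ← mul_assoc (star (s j)), hs]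
      split_ifs <;> simp
    simp only [Finset.sum_mul_sum, smul_mul_smul_comm, key, Matrix.mul_apply, Finset.sum_smul]
    refine Finset.sum_congr rfl fun i _ => ?_
    rw [Finset.sum_comm]
    refine Finset.sum_congr rfl fun k _ => ?_
    rw [Finset.sum_comm]
    simp
  map_star' B := by
    simp only [star_sum, star_smul, star_mul, star_star, Matrix.star_apply]
    exact Finset.sum_comm

end Cuntz

/-! ### The grading and density of words in each degree -/

namespace CuntzAlgebra

open Cuntz

variable {n : ℕ}

theorem mul_mem_degree {d e : ℤ} {x y : CuntzAlgebra.{u} n} (hx : x ∈ degree n d)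
    (hy : y ∈ degree n e) : x * y ∈ degree n (d + e) := fun z => by
  rw [map_mul, hx z, hy z, smul_mul_smul_comm, zpow_add₀ (Circle.coe_ne_zero z)]

theorem star_mem_degree {d : ℤ} {x : CuntzAlgebra.{u} n} (hx : x ∈ degree n d) :
    star x ∈ degree n (-d) := fun z => by
  rw [map_star, hx z, star_smul, star_zpow₀, zpow_neg, ← inv_zpow]
  simp [← Circle.coe_inv_eq_conj]

theorem one_mem_degree : (1 : CuntzAlgebra.{u} n) ∈ degree n 0 := fun z => by simp

theorem S_mem_degree (i : Fin n) : S.{u} i ∈ degree n 1 := fun z => by simp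

theorem word_mem_degree (l : List (Fin n)) : word S.{u} l ∈ degree n l.length := by
  induction l with
  | nil => exact one_mem_degree
  | cons i l ih =>
    rw [word_cons, List.length_cons, Nat.cast_succ, add_comm]
    exact mul_mem_degree (S_mem_degree i) ih

variable (n) in
/-- The span of the elements `S_μ S_ν⋆` with `|μ| - |ν| = d`. -/
noncomputable def wordSpan (d : ℤ) : Submodule ℂ (CuntzAlgebra.{u} n) :=
  Submodule.span ℂ {x | ∃ l l' : List (Fin n), (l.length : ℤ) - l'.length = d ∧
    x = word S l * star (word S l')}

theorem word_mul_star_word_mem_wordSpan {d : ℤ} (l l' : List (Fin n))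
    (h : (l.length : ℤ) - l'.length = d) : word S.{u} l * star (word S l') ∈ wordSpan n d :=
  Submodule.subset_span ⟨l, l', h, rfl⟩

theorem wordSpan_le_degree (d : ℤ) : wordSpan.{u} n d ≤ degree n d := by
  refine Submodule.span_le.mpr ?_
  rintro _ ⟨l, l', rfl, rfl⟩
  rw [sub_eq_add_neg]
  exact mul_mem_degree (word_mem_degree l) (star_mem_degree (word_mem_degree l'))

theorem S_mul_mem_iSup_wordSpan (i : Fin n) {x : CuntzAlgebra.{u} n}
    (hx : x ∈ ⨆ d, wordSpan n d) : S i * x ∈ ⨆ d, wordSpan n d := by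
  have : (⨆ d, wordSpan.{u} n d) ≤ (⨆ d, wordSpan n d).comap (LinearMap.mulLeft ℂ (S i)) := by
    refine iSup_le fun d => Submodule.span_le.mpr ?_
    rintro _ ⟨l, l', rfl, rfl⟩
    change S i * (word S l * star (word S l')) ∈ ⨆ d, wordSpan.{u} n d
    rw [← mul_assoc, ← word_cons]
    exact Submodule.mem_iSup_of_mem _ (word_mul_star_word_mem_wordSpan _ _ rfl)
  exact this hx

theorem star_S_mul_mem_iSup_wordSpan (i : Fin n) {x : CuntzAlgebra.{u} n}
    (hx : x ∈ ⨆ d, wordSpan n d) : star (S i) * x ∈ ⨆ d, wordSpan n d := by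
  have : (⨆ d, wordSpan.{u} n d) ≤
      (⨆ d, wordSpan n d).comap (LinearMap.mulLeft ℂ (star (S i))) := by
    refine iSup_le fun d => Submodule.span_le.mpr ?_
    rintro _ ⟨l, l', rfl, rfl⟩
    change star (S i) * (word S l * star (word S l')) ∈ ⨆ d, wordSpan.{u} n d
    cases l with
    | nil =>
      have h : star (S i) * (word S [] * star (word S l')) =
          word S [] * star (word S.{u} (l' ++ [i])) := by simp [word_append]
      rw [h]
      exact Submodule.mem_iSup_of_mem _ (word_mul_star_word_mem_wordSpan _ _ rfl)
    | cons j l =>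
      rw [word_cons, mul_assoc, ← mul_assoc, relations.star_gen_mul_gen]
      split_ifs
      · rw [one_mul]
        exact Submodule.mem_iSup_of_mem _ (word_mul_star_word_mem_wordSpan _ _ rfl)
      · simp
  exact this hx

theorem adjoin_le_iSup_wordSpan {x : CuntzAlgebra.{u} n}
    (hx : x ∈ StarAlgebra.adjoin ℂ (Set.range (S : Fin n → CuntzAlgebra.{u} n))) :
    x ∈ ⨆ d, wordSpan.{u} n d := by
  -- The claim is strengthened to stability under left multiplication by both `x` and `x⋆`, which
  -- passes through products and adjoints; evaluation at `1` recovers it.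
  suffices h : (∀ y ∈ ⨆ d, wordSpan.{u} n d, x * y ∈ ⨆ d, wordSpan.{u} n d) ∧
      ∀ y ∈ ⨆ d, wordSpan.{u} n d, star x * y ∈ ⨆ d, wordSpan.{u} n d by
    have h1 : (1 : CuntzAlgebra.{u} n) ∈ ⨆ d, wordSpan.{u} n d := by
      refine Submodule.mem_iSup_of_mem 0 ?_
      simpa using word_mul_star_word_mem_wordSpan.{u} (n := n) [] [] (by simp)
    simpa using h.1 1 h1
  induction hx using StarAlgebra.adjoin_induction with
  | mem x hx =>
    obtain ⟨i, rfl⟩ := hx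
    exact ⟨fun y => S_mul_mem_iSup_wordSpan i, fun y => star_S_mul_mem_iSup_wordSpan i⟩
  | algebraMap r =>
    constructor <;> intro y hy
    · rw [← Algebra.smul_def]
      exact Submodule.smul_mem _ _ hy
    · rw [← algebraMap_star_comm, ← Algebra.smul_def]
      exact Submodule.smul_mem _ _ hy
  | add a b _ _ ha hb =>
    constructor <;> intro y hy
    · rw [add_mul]
      exact Submodule.add_mem _ (ha.1 y hy) (hb.1 y hy)
    · rw [star_add, add_mul]
      exact Submodule.add_mem _ (ha.2 y hy) (hb.2 y hy)
  | mul a b _ _ ha hb =>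
    constructor <;> intro y hy
    · rw [mul_assoc]
      exact ha.1 _ (hb.1 y hy)
    · rw [star_mul, mul_assoc]
      exact hb.2 _ (ha.2 y hy)
  | star a _ ha => exact ⟨ha.2, by simpa using ha.1⟩

theorem dense_iSup_wordSpan (x : CuntzAlgebra.{u} n) :
    x ∈ closure ((⨆ d, wordSpan.{u} n d : Submodule ℂ (CuntzAlgebra.{u} n)) : Set _) := by
  have hx : x ∈ (StarAlgebra.adjoin ℂ
      (Set.range (S : Fin n → CuntzAlgebra.{u} n))).topologicalClosure := by
    rw [closure_adjoin_S]; trivial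
  exact closure_mono (fun _ => adjoin_le_iSup_wordSpan) hx

/-- The average of `ω ^ (-d) α_ω(a)` over the `N`-th roots of unity `ω`. -/
noncomputable def rootAverage (d : ℤ) (N : ℕ) (a : CuntzAlgebra.{u} n) : CuntzAlgebra.{u} n :=
  (N : ℂ)⁻¹ • ∑ k ∈ Finset.range N, ((Circle.exp (2 * Real.pi / N) ^ k : Circle) : ℂ) ^ (-d) •
    gauge n (Circle.exp (2 * Real.pi / N) ^ k) a

theorem rootAverage_sub (d : ℤ) (N : ℕ) (a b : CuntzAlgebra.{u} n) :
    rootAverage d N (a - b) = rootAverage d N a - rootAverage d N b := by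
  simp [rootAverage, smul_sub, Finset.sum_sub_distrib]

theorem rootAverage_sum {ι : Type*} (d : ℤ) (N : ℕ) (s : Finset ι) (f : ι → CuntzAlgebra.{u} n) :
    rootAverage d N (∑ i ∈ s, f i) = ∑ i ∈ s, rootAverage d N (f i) := by
  simp only [rootAverage, map_sum, Finset.smul_sum]
  exact Finset.sum_comm

theorem norm_rootAverage_le (d : ℤ) (N : ℕ) (a : CuntzAlgebra.{u} n) :
    ‖rootAverage d N a‖ ≤ ‖a‖ := by
  rcases eq_or_ne N 0 with rfl | hN
  · simp [rootAverage]
  have hN' : (0 : ℝ) < N := by positivity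
  rw [rootAverage, norm_smul, norm_inv, Complex.norm_natCast, inv_mul_le_iff₀ hN']
  refine (norm_sum_le_of_le (n := fun _ => ‖a‖) _ fun k _ => ?_).trans_eq (by simp)
  rw [norm_smul, norm_zpow, Circle.norm_coe, one_zpow, one_mul]
  exact NonUnitalStarAlgHom.norm_apply_le _ a

theorem rootAverage_of_mem_degree_of_eq {d : ℤ} {N : ℕ} (hN : N ≠ 0) {a : CuntzAlgebra.{u} n}
    (ha : a ∈ degree n d) : rootAverage d N a = a := by
  have h (z : Circle) : (z : ℂ) ^ (-d) • gauge n z a = a := by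
    rw [ha z, smul_smul, ← zpow_add₀ (Circle.coe_ne_zero z)]
    simp
  simp only [rootAverage, h]
  simp [← Nat.cast_smul_eq_nsmul ℂ, smul_smul, hN]

theorem rootAverage_of_mem_degree_of_ne {d e : ℤ} {N : ℕ} (hN : ¬ (N : ℤ) ∣ e - d)
    {a : CuntzAlgebra.{u} n} (ha : a ∈ degree n e) : rootAverage d N a = 0 := by
  rcases eq_or_ne N 0 with rfl | hN0
  · simp [rootAverage]
  have hprim : IsPrimitiveRoot ((Circle.exp (2 * Real.pi / N) : Circle) : ℂ) N := by
    convert Complex.isPrimitiveRoot_exp N hN0 using 1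
    rw [Circle.coe_exp]
    push_cast
    congr 1
    ring
  set w : ℂ := ((Circle.exp (2 * Real.pi / N) : Circle) : ℂ) with hw
  have hw0 : w ≠ 0 := Circle.coe_ne_zero _
  have hne : w ^ (e - d) ≠ 1 := fun h => hN ((hprim.zpow_eq_one_iff_dvd _).mp h)
  have hterm (k : ℕ) : ((Circle.exp (2 * Real.pi / N) ^ k : Circle) : ℂ) ^ (-d) •
      gauge n (Circle.exp (2 * Real.pi / N) ^ k) a = (w ^ (e - d)) ^ k • a := by
    rw [ha, smul_smul, ← zpow_add₀ (Circle.coe_ne_zero _), Circle.coe_pow, ← hw,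
      ← zpow_natCast, ← zpow_natCast, ← zpow_mul, ← zpow_mul]
    congr 2
    ring
  have hgeom : ∑ k ∈ Finset.range N, (w ^ (e - d)) ^ k = 0 := by
    rw [geom_sum_eq hne, ← zpow_natCast, ← zpow_mul, mul_comm, zpow_mul, zpow_natCast,
      hprim.pow_eq_one]
    simp
  simp only [rootAverage, hterm, ← Finset.sum_smul, hgeom, zero_smul, smul_zero]

/-- An element of degree `d` is a limit of linear combinations of words of degree `d`. -/
theorem degree_subset_closure_wordSpan {d : ℤ} {x : CuntzAlgebra.{u} n} (hx : x ∈ degree n d) :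
    x ∈ closure (wordSpan.{u} n d : Set (CuntzAlgebra.{u} n)) := by
  rw [Metric.mem_closure_iff]
  intro ε hε
  obtain ⟨b, hb, hxb⟩ := Metric.mem_closure_iff.mp (dense_iSup_wordSpan x) ε hε
  obtain ⟨f, hf, rfl⟩ := (Submodule.mem_iSup_iff_exists_finsupp _ _).mp hb
  -- `N` exceeds every `|e - d|`, so averaging over `N`-th roots of unity annihilates each component
  -- of degree `e ≠ d` exactly. A finite average suffices, with no integral over the circle.
  let N : ℕ := (∑ e ∈ f.support, (e - d).natAbs) + 1
  have hN (e : ℤ) (he : e ∈ f.support) (hed : e ≠ d) : ¬ (N : ℤ) ∣ e - d := by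
    rw [Int.natCast_dvd]
    refine Nat.not_dvd_of_pos_of_lt (by omega) (Nat.lt_succ_of_le ?_)
    exact Finset.single_le_sum (f := fun e => (e - d).natAbs) (fun _ _ => Nat.zero_le _) he
  refine ⟨rootAverage d N (f.sum fun _ y => y), ?_, ?_⟩
  · rw [Finsupp.sum, rootAverage_sum]
    refine Submodule.sum_mem _ fun e he => ?_
    rcases eq_or_ne e d with rfl | hed
    · rw [rootAverage_of_mem_degree_of_eq (Nat.succ_ne_zero _) (wordSpan_le_degree _ (hf e))]
      exact hf e
    · rw [rootAverage_of_mem_degree_of_ne (hN e he hed) (wordSpan_le_degree _ (hf e))]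
      exact Submodule.zero_mem _
  · rw [dist_eq_norm] at hxb ⊢
    -- The average fixes `x` and is contractive, so the approximation gets no worse.
    calc _ = ‖rootAverage d N (x - f.sum fun _ y => y)‖ := by
          rw [rootAverage_sub, rootAverage_of_mem_degree_of_eq (Nat.succ_ne_zero _) hx]
      _ < ε := (norm_rootAverage_le _ _ _).trans_lt hxb

end CuntzAlgebra

/-! ### Nontriviality of the Cuntz algebra -/

namespace Cuntz

/-- Isometries of a Hilbert space that permute a Hilbert basis along a bijection
`Fin n × κ ≃ κ` form a Cuntz family. -/
theorem exists_relations_of_equiv {n : ℕ} {κ : Type u} (e : Fin n × κ ≃ κ) :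
    ∃ T : Fin n → (lp (fun _ : κ => ℂ) 2 →L[ℂ] lp (fun _ : κ => ℂ) 2), Relations T := by
  classical
  let b : HilbertBasis κ ℂ (lp (fun _ : κ => ℂ) 2) := ⟨LinearIsometryEquiv.refl ℂ _⟩
  have hort (i : Fin n) : Orthonormal ℂ fun k => b (e (i, k)) :=
    b.orthonormal.comp _ fun k l hkl => by simpa using hkl
  let V (i : Fin n) := (hort i).orthogonalFamily.linearIsometry
  let T (i : Fin n) := (V i).toContinuousLinearMap
  have hTb (i : Fin n) (k : κ) : T i (b k) = b (e (i, k)) := by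
    have : b k = lp.single 2 k (1 : ℂ) := by
      rw [← b.repr_symm_single]; rfl
    rw [this]
    simp [T, V, OrthogonalFamily.linearIsometry_apply_single]
  have hcoord (f : lp (fun _ : κ => ℂ) 2) (i : Fin n) (k : κ) :
      inner ℂ (b k) ((star (T i)) f) = inner ℂ (b (e (i, k))) f := by
    rw [ContinuousLinearMap.star_eq_adjoint, ContinuousLinearMap.adjoint_inner_right, hTb]
  have hadj (i j : Fin n) (k : κ) : star (T i) (b (e (j, k))) = if i = j then b k else 0 := by
    apply b.repr.injective
    ext l
    rw [b.repr_apply_apply, hcoord, orthonormal_iff_ite.mp b.orthonormal, apply_ite b.repr,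
      b.repr_self]
    split_ifs <;> simp_all
  refine ⟨T, fun i => (V i).adjoint_comp_self, ?_⟩
  refine ContinuousLinearMap.ext_on (s := Set.range b)
    (Submodule.dense_iff_topologicalClosure_eq_top.mpr b.dense_span) ?_
  rintro _ ⟨p, rfl⟩
  obtain ⟨⟨j, k⟩, rfl⟩ := e.surjective p
  simp [hadj, apply_ite, hTb]

/-- Without a family the ambient product would be zero. For `n ≠ 0`, `Fin n × ℕ` and `ℕ` are both
countably infinite, which supplies the bijection. -/
instance {n : ℕ} [NeZero n] : Nonempty (Family.{u} n) := by
  have e : Fin n × ULift.{u} ℕ ≃ ULift.{u} ℕ := (nonempty_equiv_of_countable).some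
  obtain ⟨T, hT⟩ := exists_relations_of_equiv e
  have : Nontrivial (lp (fun _ : ULift.{u} ℕ => ℂ) 2) := by
    refine ⟨lp.single 2 ⟨0⟩ 1, 0, fun h => ?_⟩
    simpa using congrArg norm h
  exact ⟨{ carrier := _, gen := T, rel := hT }⟩

end Cuntz

instance {n : ℕ} [NeZero n] : Nontrivial (CuntzAlgebra.{u} n) := by
  obtain ⟨F⟩ := (inferInstance : Nonempty (Cuntz.Family.{u} n))
  refine ⟨1, 0, fun h => ?_⟩
  have h' : (CuntzAlgebra.incl n 1) F = (CuntzAlgebra.incl n 0) F := by rw [h]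
  rw [map_one, map_zero] at h'
  exact one_ne_zero h'

/-! ### The limit state -/

namespace CuntzAlgebra

open Cuntz

variable {n : ℕ}

theorem mem_scalarLimit (hn : 2 ≤ n) (a : CuntzAlgebra.{u} n) :
    a ∈ scalarLimit (S : Fin n → CuntzAlgebra.{u} n) := by
  have : NeZero n := ⟨by omega⟩
  have hle : (⨆ d, wordSpan.{u} n d) ≤ scalarLimit S := by
    refine iSup_le fun d => Submodule.span_le.mpr ?_
    rintro _ ⟨l, l', -, rfl⟩
    exact relations.word_mul_star_word_mem_scalarLimit hn l l'
  have hcl := relations.{u} (n := n).isClosed_scalarLimit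
  exact hcl.closure_subset_iff.mpr hle (dense_iSup_wordSpan a)

/-- The state with `φ(a) 1 = lim Φᵐ(a)`, where `Φ` is the averaged compression. -/
noncomputable def kmsState (hn : 2 ≤ n) : CuntzAlgebra.{u} n →ₗ[ℂ] ℂ :=
  have : NeZero n := ⟨by omega⟩
  have huniq {a : CuntzAlgebra.{u} n} {c d : ℂ}
      (hc : Tendsto (fun m => (compress S ^ m) a) atTop (𝓝 (c • 1)))
      (hd : Tendsto (fun m => (compress S ^ m) a) atTop (𝓝 (d • 1))) : c = d :=
    smul_left_injective ℂ one_ne_zero (tendsto_nhds_unique hc hd)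
  { toFun := fun a => (mem_scalarLimit hn a).choose
    map_add' := fun a b => by
      refine huniq (mem_scalarLimit hn (a + b)).choose_spec ?_
      simpa [add_smul] using
        (mem_scalarLimit hn a).choose_spec.add (mem_scalarLimit hn b).choose_spec
    map_smul' := fun r a => by
      refine huniq (mem_scalarLimit hn (r • a)).choose_spec ?_
      simpa [mul_smul] using (mem_scalarLimit hn a).choose_spec.const_smul r }

variable (hn : 2 ≤ n)

theorem tendsto_kmsState (a : CuntzAlgebra.{u} n) :
    Tendsto (fun m => (compress S ^ m) a) atTop (𝓝 (kmsState hn a • 1)) :=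
  (mem_scalarLimit hn a).choose_spec

theorem kmsState_eq_of_tendsto {a : CuntzAlgebra.{u} n} {c : ℂ}
    (hc : Tendsto (fun m => (compress S ^ m) a) atTop (𝓝 (c • 1))) : kmsState hn a = c := by
  have : NeZero n := ⟨by omega⟩
  exact smul_left_injective ℂ one_ne_zero (tendsto_nhds_unique (tendsto_kmsState hn a) hc)

theorem kmsState_one : kmsState.{u} hn 1 = 1 :=
  kmsState_eq_of_tendsto hn (by simp [relations.compress_pow_one (by omega : n ≠ 0)])

theorem kmsState_star (a : CuntzAlgebra.{u} n) : kmsState hn (star a) = star (kmsState hn a) :=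
  kmsState_eq_of_tendsto hn (by simpa [compress_pow_star] using (tendsto_kmsState hn a).star)

theorem kmsState_compress (a : CuntzAlgebra.{u} n) : kmsState hn (compress S a) = kmsState hn a :=
  (kmsState_eq_of_tendsto hn ((tendsto_add_atTop_iff_nat 1).mp
    (tendsto_kmsState hn (compress S a)))).symm

theorem norm_kmsState_le (a : CuntzAlgebra.{u} n) : ‖kmsState hn a‖ ≤ ‖a‖ := by
  have : NeZero n := ⟨by omega⟩
  have h := le_of_tendsto (tendsto_kmsState hn a).norm
    (Eventually.of_forall fun m => relations.norm_compress_pow_le m a)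
  simpa [norm_smul] using h

theorem continuous_kmsState : Continuous (kmsState.{u} hn) :=
  AddMonoidHomClass.continuous_of_bound (kmsState hn) 1 fun a => by
    simpa using norm_kmsState_le hn a

open scoped ComplexOrder in
theorem kmsState_star_mul_self_nonneg (a : CuntzAlgebra.{u} n) :
    0 ≤ kmsState hn (star a * a) := by
  have : NeZero n := ⟨by omega⟩
  let := CStarAlgebra.spectralOrder (CuntzAlgebra.{u} n)
  have := CStarAlgebra.spectralOrderedRing (CuntzAlgebra.{u} n)
  have hcompress (x : CuntzAlgebra.{u} n) (hx : 0 ≤ x) : 0 ≤ compress S x := by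
    have h : 0 ≤ ∑ i, star (S i) * x * S i :=
      Finset.sum_nonneg fun i _ => star_left_conjugate_nonneg hx _
    rw [compress_apply]
    have hr : ((n : ℂ)⁻¹) • ∑ i, star (S i) * x * S i =
        ((n : ℝ)⁻¹) • ∑ i, star (S i) * x * S i := by
      rw [← Complex.coe_smul]; simp
    rw [hr]
    exact smul_nonneg (by positivity) h
  have hpow (m : ℕ) : 0 ≤ (compress S ^ m) (star a * a) := by
    induction m with
    | zero => exact star_mul_self_nonneg a
    | succ m ih =>
      rw [pow_succ', Module.End.mul_apply]
      exact hcompress _ ih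
  have hlim : (0 : CuntzAlgebra.{u} n) ≤ kmsState hn (star a * a) • 1 :=
    ge_of_tendsto' (tendsto_kmsState hn (star a * a)) hpow
  -- The sign of a scalar `c` is read off from `c 1 ≥ 0`, whose spectrum is `{c}`.
  refine spectrum_nonneg_of_nonneg hlim ?_
  rw [← Algebra.algebraMap_eq_smul_one, spectrum.scalar_eq]
  rfl

/-- Cauchy–Schwarz for the positive semidefinite form `(a, b) ↦ φ(a⋆b)`. -/
theorem kmsState_star_mul_eq_zero {x : CuntzAlgebra.{u} n} (hx : kmsState hn (star x * x) = 0)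
    (w : CuntzAlgebra.{u} n) : kmsState hn (star x * w) = 0 := by
  let core : PreInnerProductSpace.Core ℂ (CuntzAlgebra.{u} n) :=
    { inner := fun a b => kmsState hn (star a * b)
      conj_inner_symm := fun a b => by
        rw [starRingEnd_apply, ← kmsState_star, star_mul, star_star]
      re_inner_nonneg := fun a => (Complex.nonneg_iff.mp (kmsState_star_mul_self_nonneg hn a)).1
      add_left := fun a b c => by rw [star_add, add_mul, map_add]
      smul_left := fun a b r => by rw [star_smul, smul_mul_assoc, map_smul]; rfl }
  have h : ‖kmsState hn (star x * w)‖ * ‖kmsState hn (star w * x)‖ ≤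
      (kmsState hn (star x * x)).re * (kmsState hn (star w * w)).re :=
    InnerProductSpace.Core.inner_mul_inner_self_le (c := core) x w
  have hs : star w * x = star (star x * w) := by rw [star_mul, star_star]
  rw [hx, hs, kmsState_star, norm_star, Complex.zero_re, zero_mul] at h
  exact norm_eq_zero.mp (mul_self_eq_zero.mp (le_antisymm h (mul_self_nonneg _)))

/-! ### The KMS condition -/

/-- The elements `b` with `φ(b a) = n ^ (-d) φ(a b)` for all `a`. -/
noncomputable def kmsSubmodule (d : ℤ) : Submodule ℂ (CuntzAlgebra.{u} n) where
  carrier := {b | ∀ a, kmsState hn (b * a) = (n : ℂ) ^ (-d) * kmsState hn (a * b)}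
  add_mem' hb hc a := by rw [add_mul, map_add, hb, hc, mul_add a, map_add, mul_add]
  zero_mem' a := by simp
  smul_mem' r b hb a := by
    rw [smul_mul_assoc, mul_smul_comm, map_smul, map_smul, hb, smul_eq_mul, smul_eq_mul]
    ring

theorem mul_mem_kmsSubmodule {d e : ℤ} {b c : CuntzAlgebra.{u} n} (hb : b ∈ kmsSubmodule hn d)
    (hc : c ∈ kmsSubmodule hn e) : b * c ∈ kmsSubmodule hn (d + e) := fun a => by
  have hn0 : (n : ℂ) ≠ 0 := by exact_mod_cast (by omega : n ≠ 0)
  rw [mul_assoc, hb, mul_assoc, hc, neg_add, zpow_add₀ hn0, mul_assoc a, mul_assoc]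

/-- Invariance of `φ` under `Φ`, together with `Φ(Sᵢ a) = n⁻¹ a Sᵢ`. -/
theorem S_mem_kmsSubmodule (i : Fin n) : S.{u} i ∈ kmsSubmodule hn 1 := fun a => by
  rw [← kmsState_compress, relations.compress_mul_left, map_smul]
  simp

theorem star_S_mem_kmsSubmodule (i : Fin n) : star (S.{u} i) ∈ kmsSubmodule hn (-1) := fun a => by
  have hn0 : (n : ℂ) ≠ 0 := by exact_mod_cast (by omega : n ≠ 0)
  rw [← kmsState_compress hn (a * _), relations.compress_mul_star, map_smul]
  simp [hn0]

theorem word_mem_kmsSubmodule (l : List (Fin n)) : word S.{u} l ∈ kmsSubmodule hn l.length := by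
  induction l with
  | nil => intro a; simp
  | cons i l ih =>
    rw [word_cons, List.length_cons, Nat.cast_succ, add_comm]
    exact mul_mem_kmsSubmodule hn (S_mem_kmsSubmodule hn i) ih

theorem star_word_mem_kmsSubmodule (l : List (Fin n)) :
    star (word S.{u} l) ∈ kmsSubmodule hn (-l.length) := by
  induction l with
  | nil => intro a; simp
  | cons i l ih =>
    rw [word_cons, star_mul, List.length_cons, Nat.cast_succ, neg_add]
    exact mul_mem_kmsSubmodule hn ih (star_S_mem_kmsSubmodule hn i)

theorem degree_le_kmsSubmodule (d : ℤ) : degree n d ≤ kmsSubmodule.{u} hn d := by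
  intro x hx
  have hle : wordSpan.{u} n d ≤ kmsSubmodule hn d := by
    refine Submodule.span_le.mpr ?_
    rintro _ ⟨l, l', rfl, rfl⟩
    exact mul_mem_kmsSubmodule hn (word_mem_kmsSubmodule hn l) (star_word_mem_kmsSubmodule hn l')
  have hcl : IsClosed (kmsSubmodule.{u} hn d : Set (CuntzAlgebra.{u} n)) := by
    have : (kmsSubmodule.{u} hn d : Set (CuntzAlgebra.{u} n)) =
      ⋂ a, {b | kmsState hn (b * a) = (n : ℂ) ^ (-d) * kmsState hn (a * b)} := by
        ext b; simp [kmsSubmodule]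
    rw [this]
    have hc := continuous_kmsState.{u} hn
    exact isClosed_iInter fun a => isClosed_eq (by fun_prop) (by fun_prop)
  exact hcl.closure_subset_iff.mpr hle (degree_subset_closure_wordSpan hx)

end CuntzAlgebra

/-! ### Matrix algebras in degree zero and faithfulness -/

namespace CuntzAlgebra

open Cuntz

variable {n : ℕ}

open scoped Matrix.Norms.L2Operator

/-- The ⋆-homomorphism `M_{nᵏ}(ℂ) → 𝒪ₙ` whose matrix units are `S_μ S_ν⋆` for words of
length `k`. -/
noncomputable def coreHom (k : ℕ) :
    Matrix (List.Vector (Fin n) k) (List.Vector (Fin n) k) ℂ →⋆ₙₐ[ℂ] CuntzAlgebra.{u} n :=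
  matrixHom (fun l => word S l.toList) fun l l' => by
    rw [relations.star_word_mul_word _ _ (by simp)]
    simp only [List.Vector.toList_injective.eq_iff]

theorem coreHom_apply (k : ℕ)
    (B : Matrix (List.Vector (Fin n) k) (List.Vector (Fin n) k) ℂ) :
    coreHom.{u} k B = ∑ l, ∑ l', B l l' • (word S l.toList * star (word S l'.toList)) := rfl

theorem coreHom_single (k : ℕ) (l l' : List.Vector (Fin n) k) :
    coreHom.{u} k (Matrix.single l l' 1) = word S l.toList * star (word S l'.toList) := by
  rw [coreHom_apply]
  simp [Matrix.single_apply, ite_and]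

theorem word_mul_star_word_mem_range_coreHom {k : ℕ} {l l' : List (Fin n)} (hl : l.length = k)
    (hl' : l'.length = k) : ∃ B, coreHom.{u} k B = word S l * star (word S l') :=
  ⟨Matrix.single ⟨l, hl⟩ ⟨l', hl'⟩ 1, coreHom_single k ⟨l, hl⟩ ⟨l', hl'⟩⟩

/-- Inserting `1 = ∑ Sᵢ Sᵢ⋆` between `S_μ` and `S_ν⋆` lengthens both words by one letter. The ranges
thus increase with `k`, and a single `k` serves any finite combination. -/
theorem coreHom_mem_range_succ (k : ℕ)
    (B : Matrix (List.Vector (Fin n) k) (List.Vector (Fin n) k) ℂ) :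
    coreHom.{u} k B ∈
      LinearMap.range (LinearMapClass.linearMap (coreHom.{u} (n := n) (k + 1))) := by
  rw [coreHom_apply]
  refine Submodule.sum_mem _ fun l _ => Submodule.sum_mem _ fun l' _ => Submodule.smul_mem _ _ ?_
  have h : word S.{u} l.toList * star (word S l'.toList) =
      ∑ i, word S (l.toList ++ [i]) * star (word S (l'.toList ++ [i])) := by
    calc _ = word S.{u} l.toList * (∑ i, S i * star (S i)) * star (word S l'.toList) := by
          rw [relations.sum_range, mul_one]
      _ = _ := by simp [Finset.mul_sum, Finset.sum_mul, word_append, mul_assoc]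
  rw [h]
  exact Submodule.sum_mem _ fun i _ => word_mul_star_word_mem_range_coreHom (by simp) (by simp)

theorem exists_coreHom_of_mem_wordSpan {b : CuntzAlgebra.{u} n} (hb : b ∈ wordSpan n 0) :
    ∃ k B, coreHom.{u} k B = b := by
  have hmono : Monotone fun k =>
      LinearMap.range (LinearMapClass.linearMap (coreHom.{u} (n := n) k)) := by
    refine monotone_nat_of_le_succ fun k => ?_
    rintro _ ⟨B, rfl⟩
    exact coreHom_mem_range_succ k B
  have hle : wordSpan.{u} n 0 ≤
      ⨆ k, LinearMap.range (LinearMapClass.linearMap (coreHom.{u} (n := n) k)) := by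
    refine Submodule.span_le.mpr ?_
    rintro _ ⟨l, l', h, rfl⟩
    exact Submodule.mem_iSup_of_mem l.length
      (word_mul_star_word_mem_range_coreHom rfl (by omega))
  obtain ⟨k, B, hB⟩ := (Submodule.mem_iSup_of_directed _ hmono.directed_le).mp (hle hb)
  exact ⟨k, B, hB⟩

/-- The linear combination `∑ ξ_μ S_μ` over the words of length `k`. -/
noncomputable def wordVec (k : ℕ) (ξ : EuclideanSpace ℂ (List.Vector (Fin n) k)) :
    CuntzAlgebra.{u} n :=
  ∑ l, ξ l • word S l.toList

/-- Words of equal length behave like an orthonormal basis. Sandwiching `coreHom k B` between two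
such vectors therefore yields the matrix coefficient `⟨ξ, Bη⟩` times `1`. -/
theorem star_wordVec_mul_wordVec (k : ℕ) (ξ η : EuclideanSpace ℂ (List.Vector (Fin n) k)) :
    star (wordVec.{u} k ξ) * wordVec k η = inner ℂ ξ η • 1 := by
  have h (l l' : List.Vector (Fin n) k) : star (word S.{u} l.toList) * word S l'.toList =
      if l = l' then 1 else 0 := by
    rw [relations.star_word_mul_word _ _ (by simp)]
    simp only [List.Vector.toList_injective.eq_iff]
  simp only [wordVec, star_sum, star_smul, Finset.sum_mul_sum, smul_mul_smul_comm, h,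
    PiLp.inner_apply, Finset.sum_smul]
  simp [mul_comm]

theorem norm_wordVec_le [NeZero n] (k : ℕ) (ξ : EuclideanSpace ℂ (List.Vector (Fin n) k)) :
    ‖wordVec.{u} k ξ‖ ≤ ‖ξ‖ := by
  have h := CStarRing.norm_star_mul_self (x := wordVec.{u} k ξ)
  rw [star_wordVec_mul_wordVec, inner_self_eq_norm_sq_to_K, norm_smul, norm_one, mul_one] at h
  refine abs_le_of_sq_le_sq' ?_ (norm_nonneg _) |>.2
  rw [sq, ← h]
  simp

theorem coreHom_mul_wordVec (k : ℕ)
    (B : Matrix (List.Vector (Fin n) k) (List.Vector (Fin n) k) ℂ)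
    (η : EuclideanSpace ℂ (List.Vector (Fin n) k)) :
    coreHom.{u} k B * wordVec k η = wordVec k (Matrix.toEuclideanCLM (𝕜 := ℂ) B η) := by
  have h (l l' l'' : List.Vector (Fin n) k) :
      word S.{u} l.toList * star (word S l'.toList) * word S l''.toList =
      if l' = l'' then word S l.toList else 0 := by
    rw [mul_assoc, relations.star_word_mul_word _ _ (by simp)]
    simp only [List.Vector.toList_injective.eq_iff, mul_ite, mul_one, mul_zero]
  rw [coreHom_apply]
  simp only [wordVec, Finset.sum_mul, Finset.mul_sum, smul_mul_smul_comm, h]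
  rw [Finset.sum_comm]
  simp [Matrix.ofLp_toEuclideanCLM, Matrix.mulVec, dotProduct, Finset.sum_smul]

variable (hn : 2 ≤ n)

theorem star_wordVec_mem_kmsSubmodule (k : ℕ) (ξ : EuclideanSpace ℂ (List.Vector (Fin n) k)) :
    star (wordVec.{u} k ξ) ∈ kmsSubmodule hn (-k) := by
  rw [wordVec, star_sum]
  refine Submodule.sum_mem _ fun l _ => ?_
  rw [star_smul]
  refine Submodule.smul_mem _ _ ?_
  simpa using star_word_mem_kmsSubmodule.{u} hn l.toList

/-- An element of degree zero that is orthogonal to everything in the state vanishes. -/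
theorem eq_zero_of_kmsState_mul_eq_zero {y : CuntzAlgebra.{u} n} (hy : y ∈ degree n 0)
    (h0 : ∀ c, kmsState hn (y * c) = 0) : y = 0 := by
  have : NeZero n := ⟨by omega⟩
  rw [← norm_le_zero_iff]
  refine le_of_forall_pos_le_add fun ε hε => ?_
  obtain ⟨b, hb, hyb⟩ := Metric.mem_closure_iff.mp (degree_subset_closure_wordSpan hy) (ε / 2)
    (half_pos hε)
  obtain ⟨k, B, rfl⟩ := exists_coreHom_of_mem_wordSpan hb
  rw [dist_eq_norm] at hyb
  have hinner (ξ η : EuclideanSpace ℂ (List.Vector (Fin n) k)) :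
      ‖inner ℂ ξ (Matrix.toEuclideanCLM (𝕜 := ℂ) B η)‖ ≤ ε / 2 * ‖ξ‖ * ‖η‖ := by
    have hB : kmsState hn (star (wordVec k ξ) * (coreHom k B * wordVec k η)) =
        inner ℂ ξ (Matrix.toEuclideanCLM (𝕜 := ℂ) B η) := by
      rw [coreHom_mul_wordVec, star_wordVec_mul_wordVec, map_smul, kmsState_one, smul_eq_mul,
        mul_one]
    -- The scaling rule carries the left factor past `y`, so that the hypothesis on `φ(y c)`
    -- applies.
    have hy0 : kmsState hn (star (wordVec k ξ) * (y * wordVec k η)) = 0 := by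
      rw [star_wordVec_mem_kmsSubmodule hn k ξ, mul_assoc, h0, mul_zero]
    calc _ = ‖kmsState hn (star (wordVec k ξ) * ((y - coreHom k B) * wordVec k η))‖ := by
          rw [sub_mul, mul_sub, map_sub, hy0, hB, zero_sub, norm_neg]
      _ ≤ ‖star (wordVec k ξ) * ((y - coreHom k B) * wordVec k η)‖ := norm_kmsState_le hn _
      _ ≤ ‖star (wordVec.{u} k ξ)‖ * (‖y - coreHom k B‖ * ‖wordVec.{u} k η‖) :=
        (norm_mul_le _ _).trans (mul_le_mul_of_nonneg_left (norm_mul_le _ _) (norm_nonneg _))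
      _ ≤ ‖ξ‖ * (ε / 2 * ‖η‖) := by
        rw [norm_star]
        gcongr
        exacts [norm_wordVec_le k ξ, norm_wordVec_le k η]
      _ = _ := by ring
  have hnorm : ‖B‖ ≤ ε / 2 := by
    refine ContinuousLinearMap.opNorm_le_bound (Matrix.toEuclideanCLM (𝕜 := ℂ) B) (by positivity)
      fun η => ?_
    -- Testing the coefficient bound with `ξ = Bη` turns it into an operator norm bound.
    set ζ := Matrix.toEuclideanCLM (𝕜 := ℂ) B η
    have h := hinner ζ η
    rw [inner_self_eq_norm_sq_to_K, norm_pow, RCLike.norm_ofReal, abs_norm] at h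
    rcases (norm_nonneg ζ).eq_or_lt with hz | hz
    · rw [← hz]; positivity
    · nlinarith
  -- Under the operator norm the matrices form a C⋆-algebra, so a ⋆-homomorphism out of them is
  -- contractive.
  have hcore : ‖coreHom.{u} k B‖ ≤ ‖B‖ := NonUnitalStarAlgHom.norm_apply_le _ B
  calc ‖y‖ = ‖(y - coreHom k B) + coreHom k B‖ := by rw [sub_add_cancel]
    _ ≤ ‖y - coreHom k B‖ + ‖coreHom.{u} k B‖ := norm_add_le _ _
    _ ≤ 0 + ε := by linarith

/-- A normal element of degree one for the gauge action vanishes. -/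
theorem eq_zero_of_isStarNormal_of_mem_degree_one (hn : 2 ≤ n) {x : CuntzAlgebra.{u} n}
    (hx : x ∈ degree n 1) (hnormal : IsStarNormal x) : x = 0 := by
  have hkms := degree_le_kmsSubmodule hn 1 hx (star x)
  rw [← hnormal.star_comm_self.eq, zpow_neg_one] at hkms
  have hn1 : (n : ℂ)⁻¹ ≠ 1 := by
    rw [ne_eq, inv_eq_one]
    exact_mod_cast (by omega : n ≠ 1)
  have hzero : kmsState hn (star x * x) = 0 := by
    by_contra h
    exact hn1 (mul_right_cancel₀ h (by rw [← hkms, one_mul]))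
  have hdeg : star x * x ∈ degree n 0 := by
    simpa using mul_mem_degree (star_mem_degree hx) hx
  refine (CStarRing.star_mul_self_eq_zero_iff x).mp
    (eq_zero_of_kmsState_mul_eq_zero hn hdeg fun c => ?_)
  rw [mul_assoc]
  exact kmsState_star_mul_eq_zero hn hzero _

end CuntzAlgebra

/-! ### The weak local-triviality dimension -/

namespace LocalTriviality

/-- The element `t ⊗ u` of `C₀((0,1]) ⊗ C(𝕊¹)`, where `u` is the inclusion of the circle. -/
noncomputable def coneTU : ConeAlgebra Circle where
  toFun p := ((p.1 : ℝ) : ℂ) * (p.2 : ℂ)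
  continuous_toFun := by fun_prop
  zero_at_infty' := by
    refine squeeze_zero_norm (fun p => ?_) (tendsto_zero_iff_norm_tendsto_zero.mp
      (coneT Circle).zero_at_infty')
    rw [norm_mul, Circle.norm_coe, mul_one]
    rfl

theorem coneTranslate_coneTU (z : Circle) : coneTranslate z coneTU = (z : ℂ) • coneTU := by
  ext ⟨s, h⟩
  simp [coneTU]
  ring

/-- Since `|u| = 1`, a homomorphism that kills `t ⊗ u` also kills `t ⊗ 1`, by the C⋆-identity. -/
theorem star_coneTU_mul_coneTU : star coneTU * coneTU = star (coneT Circle) * coneT Circle := by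
  ext ⟨s, h⟩
  have hh : (starRingEnd ℂ) (h : ℂ) * h = 1 := by
    rw [← Circle.coe_inv_eq_conj, ← Circle.coe_mul, inv_mul_cancel, Circle.coe_one]
  simp only [coneTU, coneT, ZeroAtInftyContinuousMap.mul_apply,
    ZeroAtInftyContinuousMap.star_apply, ZeroAtInftyContinuousMap.coe_mk, star_mul', RCLike.star_def,
    Complex.conj_ofReal]
  linear_combination ((s : ℝ) : ℂ) ^ 2 * hh

end LocalTriviality

open CuntzAlgebra LocalTriviality in
theorem mainTheorem7 (n : ℕ) (hn : 2 ≤ n) :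
    (∀ x : CuntzAlgebra.{u} n, x ∈ CuntzAlgebra.degree n 1 → IsStarNormal x → x = 0) ∧
      LocalTriviality.weakDim (CuntzAlgebra.gauge.{u} n) = ⊤ := by
  have : NeZero n := ⟨by omega⟩
  have hzero := fun (x : CuntzAlgebra.{u} n) (hx : x ∈ degree n 1) (hx' : IsStarNormal x) =>
    eq_zero_of_isStarNormal_of_mem_degree_one hn hx hx'
  refine ⟨hzero, sInf_eq_top.mpr ?_⟩
  rintro _ ⟨m, -, ρ, hρ, hunit⟩
  have hρT (i : Fin (m + 1)) : ρ i (coneT Circle) = 0 := by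
    have hU : ρ i coneTU = 0 := by
      refine hzero _ (fun z => ?_) ⟨?_⟩
      · rw [← hρ, coneTranslate_coneTU, map_smul, zpow_one]
      · rw [← map_star]
        -- Normality of the image comes from commutativity of the cone algebra.
        exact (Commute.all (star coneTU) coneTU).map (ρ i)
    rw [← CStarRing.star_mul_self_eq_zero_iff, ← map_star, ← map_mul, ← star_coneTU_mul_coneTU,
      map_mul, hU, mul_zero]
  simp [hρT] at hunit
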